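/- An observable with (measurable) outcome space $\Omega$ on a complex Hilbert space $\mathcal H$ is a normalized positive operator valued measure $\mathsf M$ on $\Omega$, i.e. a weakly $\sigma$-additive map from measurable sets to positive bounded operators with $\mathsf M(\Omega)=\mathbb 1$. It is trivial if $\mathsf M(X)=\mu(X)\mathbb 1$ for some probability measure $\mu$. Observables $\mathsf M_1,\mathsf M_2$ on $\Omega_1,\Omega_2$ are jointly measurable if there is an observable $\mathsf M$ on $\Omega_1\times\Omega_2$ with $\mathsf M(X\times\Omega_2)=\mathsf M_1(X)$ and $\mathsf M(\Omega_1\times Y)=\mathsf M_2(Y)$ for all measurable $X,Y$. The joint measurability region $J(\mathsf M_1,\mathsf M_2)$ is the set of all $(\lambda,\mu)\in[0,1]\times[0,1]$ for which there are trivial observables $\mathsf T_1,\mathsf T_2$ such that $\lambda\mathsf M_1+(1-\lambda)\mathsf T_1$ and $\mu\mathsf M_2+(1-\mu)\mathsf T_2$ are jointly measurable. The pair is maximally incompatible if $J(\mathsf M_1,\mathsf M_2)=\{(\lambda,\mu)\in[0,1]\times[0,1] : \lambda+\mu\le 1\}$, and its joint measurability degree is the greatest $\lambda\in[0,1]$ with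 $(\lambda,\lambda)\in J(\mathsf M_1,\mathsf M_2)$. Let $\mathcal H=\ell^2(\mathbb N_0)$ with its standard orthonormal basis $\{|n\rangle\}_{n\ge 0}$. Let $\mathsf N$ be the photon number observable on $\mathbb N_0$, $\mathsf N(Y)=\sum_{n\in Y}|n\rangle\langle n|$, and let $\Phi$ be the canonical phase observable on $[0,2\pi)$ (with its Borel sets), $$\Phi(X)=\sum_{m,n=0}^\infty \frac1{2\pi}\int_X e^{i(m-n)\theta}\,d\theta\;|m\rangle\langle n| .$$ **Theorem.** The observables $\mathsf N$ and $\Phi$ are maximally incompatible, and their joint measurability degree exists and equals $1/2$. -/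

import Mathlib

open MeasureTheory Set
open scoped InnerProductSpace ENNReal

noncomputable section

namespace QuantumObservables

/-- An observable (normalized positive operator valued measure) with outcome space `Ω` on a
complex Hilbert space `H`; countable additivity is in the weak operator sense.  Only the values on
measurable sets matter. -/
structure Observable (Ω : Type*) [MeasurableSpace Ω]
    (H : Type*) [NormedAddCommGroup H] [InnerProductSpace ℂ H] where
  toFun : Set Ω → H →L[ℂ] H
  isPositive' : ∀ X, MeasurableSet X → (toFun X).IsPositive
  map_univ' : toFun univ = 1
  hasSum_iUnion' : ∀ X : ℕ → Set Ω, (∀ i, MeasurableSet (X i)) → Pairwise (Function.onFun Disjoint X) →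
    ∀ φ ψ : H, HasSum (fun i => ⟪φ, toFun (X i) ψ⟫_ℂ) ⟪φ, toFun (⋃ i, X i) ψ⟫_ℂ

section General

variable {Ω Ω₁ Ω₂ : Type*} [MeasurableSpace Ω] [MeasurableSpace Ω₁] [MeasurableSpace Ω₂]
  {H : Type*} [NormedAddCommGroup H] [InnerProductSpace ℂ H]

instance : CoeFun (Observable Ω H) (fun _ => Set Ω → H →L[ℂ] H) := ⟨Observable.toFun⟩

/-- A trivial observable: `T(X) = μ(X) 1` for some probability measure `μ`. -/
def Observable.IsTrivial (T : Observable Ω H) : Prop :=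
  ∃ μ : Measure Ω, IsProbabilityMeasure μ ∧
    ∀ X, MeasurableSet X → T X = ((μ.real X : ℝ) : ℂ) • (1 : H →L[ℂ] H)

/-- The convex combination `t M + (1 - t) T` of two observables. -/
def Observable.mix (t : ℝ) (ht : t ∈ Icc (0 : ℝ) 1) (M T : Observable Ω H) : Observable Ω H where
  toFun X := (t : ℂ) • M X + ((1 - t : ℝ) : ℂ) • T X
  isPositive' X hX :=
    ((M.isPositive' X hX).smul_of_nonneg (by exact_mod_cast ht.1)).add
      ((T.isPositive' X hX).smul_of_nonneg (by exact_mod_cast sub_nonneg.2 ht.2))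
  map_univ' := by
    rw [M.map_univ', T.map_univ', ← add_smul]
    simp
  hasSum_iUnion' X hX hd φ ψ := by
    have h := ((M.hasSum_iUnion' X hX hd φ ψ).mul_left (t : ℂ)).add
      ((T.hasSum_iUnion' X hX hd φ ψ).mul_left ((1 - t : ℝ) : ℂ))
    simpa only [add_apply, smul_apply, inner_add_right, inner_smul_right] using h

/-- `M₁` and `M₂` are jointly measurable: they are the margins of one observable on the product
outcome space. -/
def JointlyMeasurable (M₁ : Observable Ω₁ H) (M₂ : Observable Ω₂ H) : Prop :=
  ∃ M : Observable (Ω₁ × Ω₂) H,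
    (∀ X, MeasurableSet X → M (X ×ˢ univ) = M₁ X) ∧
    (∀ Y, MeasurableSet Y → M (univ ×ˢ Y) = M₂ Y)

/-- The joint measurability region `J(M₁, M₂) ⊆ [0,1] × [0,1]`. -/
def jointMeasurabilityRegion (M₁ : Observable Ω₁ H) (M₂ : Observable Ω₂ H) : Set (ℝ × ℝ) :=
  {p | ∃ (h₁ : p.1 ∈ Icc (0 : ℝ) 1) (h₂ : p.2 ∈ Icc (0 : ℝ) 1)
    (T₁ : Observable Ω₁ H) (T₂ : Observable Ω₂ H), T₁.IsTrivial ∧ T₂.IsTrivial ∧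
      JointlyMeasurable (Observable.mix p.1 h₁ M₁ T₁) (Observable.mix p.2 h₂ M₂ T₂)}

/-- Maximal incompatibility: the joint measurability region is exactly the triangle
`{(s, t) ∈ [0,1] × [0,1] | s + t ≤ 1}`. -/
def MaximallyIncompatible (M₁ : Observable Ω₁ H) (M₂ : Observable Ω₂ H) : Prop :=
  jointMeasurabilityRegion M₁ M₂ =
    {p : ℝ × ℝ | p.1 ∈ Icc (0 : ℝ) 1 ∧ p.2 ∈ Icc (0 : ℝ) 1 ∧ p.1 + p.2 ≤ 1}

/-- `d` is the joint measurability degree of `M₁` and `M₂`: the greatest `t ∈ [0,1]` such that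
`(t, t)` lies in the joint measurability region. -/
def IsJointMeasurabilityDegree (M₁ : Observable Ω₁ H) (M₂ : Observable Ω₂ H) (d : ℝ) : Prop :=
  IsGreatest {t : ℝ | (t, t) ∈ jointMeasurabilityRegion M₁ M₂} d

end General

/-! ### The number observable -/

/-- The Hilbert space `ℓ²(ℕ₀)`; the number state `|n⟩` is `lp.single 2 n 1`. -/
abbrev FockSpace : Type := lp (fun _ : ℕ => ℂ) 2

/-- The projection `∑_{n ∈ Y} |n⟩⟨n|`. -/
def numberOp (Y : Set ℕ) : FockSpace →L[ℂ] FockSpace :=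
  LinearMap.mkContinuous
    { toFun := fun x => ⟨Y.indicator x, (lp.memℓp x).mono' fun n => norm_indicator_le_norm_self x n⟩
      map_add' := fun x y => by
        ext n
        exact congrFun (indicator_add Y x y) n
      map_smul' := fun c x => by
        ext n
        exact congrFun (indicator_const_smul Y c x) n }
    1 fun x => by
      rw [one_mul]
      exact lp.norm_mono (by norm_num) fun n => norm_indicator_le_norm_self x n

theorem numberOp_apply (Y : Set ℕ) (x : FockSpace) (n : ℕ) :
    numberOp Y x n = Y.indicator x n := rfl

theorem integrable_inner_count (x y : FockSpace) :
    Integrable (fun n => ⟪x n, y n⟫_ℂ) (Measure.count : Measure ℕ) :=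
  integrable_count_iff.2 (lp.summable_inner (𝕜 := ℂ) x y).norm

theorem inner_numberOp (Y : Set ℕ) (x y : FockSpace) :
    ⟪x, numberOp Y y⟫_ℂ = ∫ n in Y, ⟪x n, y n⟫_ℂ ∂Measure.count := by
  have hi : Integrable (fun n => ⟪x n, y n⟫_ℂ) (Measure.count : Measure ℕ) :=
    integrable_inner_count x y
  rw [← integral_indicator (MeasurableSet.of_discrete), integral_countable]
  · rw [lp.inner_eq_tsum]
    refine tsum_congr fun n => ?_
    by_cases h : n ∈ Y <;> simp [numberOp_apply, h]
  · exact hi.indicator MeasurableSet.of_discrete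

/-- The photon number observable `N(Y) = ∑_{n ∈ Y} |n⟩⟨n|` with outcome space `ℕ₀`. -/
def numberObservable : Observable ℕ FockSpace where
  toFun := numberOp
  isPositive' Y _ := by
    have h : numberOp Y = ContinuousLinearMap.adjoint (numberOp Y) ∘L numberOp Y := by
      refine ContinuousLinearMap.ext fun y => ext_inner_left ℂ fun x => ?_
      rw [ContinuousLinearMap.comp_apply, ContinuousLinearMap.adjoint_inner_right,
        lp.inner_eq_tsum, lp.inner_eq_tsum]
      refine tsum_congr fun n => ?_
      by_cases h : n ∈ Y <;> simp [numberOp_apply, h]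
    rw [h]
    exact ContinuousLinearMap.isPositive_adjoint_comp_self _
  map_univ' := by
    ext x n
    simp [numberOp_apply]
  hasSum_iUnion' Y hY hd x y := by
    simp only [inner_numberOp]
    exact hasSum_integral_iUnion hY hd
      (integrable_inner_count x y).integrableOn

/-! ### The canonical phase observable -/

/-- The interval `[0, 2π)` with its Borel `σ`-algebra. -/
abbrev PhaseSpace : Type := Ico (0 : ℝ) (2 * Real.pi)

/-- The uniform probability measure `dθ / 2π` on `[0, 2π)`. -/
def phaseMeasure : Measure PhaseSpace := ENNReal.ofReal (1 / (2 * Real.pi)) • Measure.comap Subtype.val (volume : Measure ℝ)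

theorem measurableEmbedding_phase : MeasurableEmbedding (Subtype.val : PhaseSpace → ℝ) :=
  MeasurableEmbedding.subtype_coe measurableSet_Ico

instance : IsProbabilityMeasure phaseMeasure := ⟨by
  rw [phaseMeasure, Measure.smul_apply, measurableEmbedding_phase.comap_apply, image_univ,
    Subtype.range_coe, Real.volume_Ico, smul_eq_mul, ← ENNReal.ofReal_mul (by positivity)]
  have hpi : Real.pi ≠ 0 := Real.pi_ne_zero
  have : 1 / (2 * Real.pi) * (2 * Real.pi - 0) = 1 := by field_simp; ring
  rw [this, ENNReal.ofReal_one]⟩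

/-- The function `θ ↦ e^{-inθ}` on `[0, 2π)`. -/
def phaseChar (n : ℕ) (θ : PhaseSpace) : ℂ := Complex.exp (-(n * (θ : ℝ) * Complex.I))

theorem memLp_phaseChar (n : ℕ) : MemLp (phaseChar n) 2 phaseMeasure := by
  refine MemLp.of_bound (C := 1) ?_ (Filter.Eventually.of_forall fun θ => ?_)
  · have : Measurable (phaseChar n) := by unfold phaseChar; fun_prop
    exact this.aestronglyMeasurable
  · have : -((n : ℂ) * ((θ : ℝ) : ℂ) * Complex.I) = ((-(n * θ : ℝ) : ℝ) : ℂ) * Complex.I := by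
      push_cast; ring
    rw [phaseChar, this, Complex.norm_exp_ofReal_mul_I]

theorem inner_phaseChar (m n : ℕ) (θ : PhaseSpace) :
    ⟪phaseChar m θ, phaseChar n θ⟫_ℂ = Complex.exp (Complex.I * ((m : ℂ) - n) * (θ : ℝ)) := by
  rw [RCLike.inner_apply, phaseChar, phaseChar, ← Complex.exp_conj, ← Complex.exp_add]
  congr 1
  simp
  ring

theorem setIntegral_phaseMeasure (X : Set PhaseSpace) (f : ℝ → ℂ) :
    ∫ θ in X, f θ ∂phaseMeasure =
      1 / (2 * Real.pi) * ∫ θ in (Subtype.val '' X : Set ℝ), f θ := by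
  have h := measurableEmbedding_phase
  have hX : (Subtype.val ⁻¹' (Subtype.val '' X : Set ℝ) : Set PhaseSpace) = X :=
    preimage_image_eq X Subtype.val_injective
  have hm : (volume : Measure ℝ).restrict (Subtype.val '' X) =
      (((volume : Measure ℝ).comap Subtype.val).restrict X).map
        (Subtype.val : PhaseSpace → ℝ) := by
    have h2 := h.restrict_map ((volume : Measure ℝ).comap Subtype.val) (Subtype.val '' X)
    rw [hX] at h2
    rw [← h2, h.map_comap, Subtype.range_coe,
      Measure.restrict_restrict_of_subset]
    rintro _ ⟨θ, -, rfl⟩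
    exact θ.2
  rw [hm, h.integral_map, phaseMeasure, Measure.restrict_smul, integral_smul_measure,
    ENNReal.toReal_ofReal (by positivity)]
  simp [Complex.real_smul]

theorem orthonormal_phaseChar :
    Orthonormal ℂ (fun n : ℕ => (memLp_phaseChar n).toLp (phaseChar n)) := by
  rw [orthonormal_iff_ite]
  intro m n
  have h1 : ⟪(memLp_phaseChar m).toLp (phaseChar m), (memLp_phaseChar n).toLp (phaseChar n)⟫_ℂ =
      ∫ θ in (univ : Set PhaseSpace), Complex.exp (Complex.I * ((m : ℂ) - n) * (θ : ℝ))
        ∂phaseMeasure := by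
    rw [L2.inner_def, Measure.restrict_univ]
    refine integral_congr_ae ?_
    filter_upwards [(memLp_phaseChar m).coeFn_toLp, (memLp_phaseChar n).coeFn_toLp] with θ h h'
    rw [h, h', inner_phaseChar]
  rw [h1, setIntegral_phaseMeasure univ
    (fun θ : ℝ => Complex.exp (Complex.I * ((m : ℂ) - n) * θ)), image_univ, Subtype.range_coe,
    integral_Ico_eq_integral_Ioo, ← integral_Ioc_eq_integral_Ioo,
    ← intervalIntegral.integral_of_le (by positivity)]
  by_cases hmn : m = n
  · subst hmn
    have hpi : (Real.pi : ℂ) ≠ 0 := by exact_mod_cast Real.pi_ne_zero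
    simp
    field_simp
  · have hc : Complex.I * ((m : ℂ) - n) ≠ 0 :=
      mul_ne_zero Complex.I_ne_zero (sub_ne_zero.2 (by exact_mod_cast hmn))
    rw [integral_exp_mul_complex hc, if_neg hmn]
    have : Complex.exp (Complex.I * ((m : ℂ) - n) * ((2 * Real.pi : ℝ) : ℂ)) = 1 := by
      rw [Complex.exp_eq_one_iff]
      exact ⟨(m : ℤ) - n, by push_cast; ring⟩
    rw [this]
    simp

/-- The isometry `ℓ²(ℕ₀) → L²([0, 2π), dθ/2π)`, `|n⟩ ↦ e^{-inθ}`. -/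
def phaseIsometry : FockSpace →ₗᵢ[ℂ] Lp ℂ 2 phaseMeasure :=
  orthonormal_phaseChar.orthogonalFamily.linearIsometry

/-- `φ ↦ (phaseIsometry φ)` restricted to `X`. -/
def phaseRestrict (X : Set PhaseSpace) : FockSpace →L[ℂ] Lp ℂ 2 (phaseMeasure.restrict X) :=
  LpToLpRestrictCLM PhaseSpace ℂ ℂ phaseMeasure 2 X ∘L phaseIsometry.toContinuousLinearMap

/-- `Φ(X)`, the bounded operator with `⟨φ, Φ(X) ψ⟩ = ∫_X conj(φ^(θ)) ψ^(θ) dθ/2π`, where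
`φ^(θ) = ∑ n, φ n e^{-inθ}`; see `phaseOp_matrix` for its matrix elements. -/
def phaseOp (X : Set PhaseSpace) : FockSpace →L[ℂ] FockSpace :=
  ContinuousLinearMap.adjoint (phaseRestrict X) ∘L phaseRestrict X

theorem inner_phaseOp (X : Set PhaseSpace) (φ ψ : FockSpace) :
    ⟪φ, phaseOp X ψ⟫_ℂ = ∫ θ in X, ⟪phaseIsometry φ θ, phaseIsometry ψ θ⟫_ℂ ∂phaseMeasure := by
  rw [phaseOp, ContinuousLinearMap.comp_apply, ContinuousLinearMap.adjoint_inner_right,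
    L2.inner_def]
  refine integral_congr_ae ?_
  filter_upwards [LpToLpRestrictCLM_coeFn ℂ X (phaseIsometry φ),
    LpToLpRestrictCLM_coeFn ℂ X (phaseIsometry ψ)] with θ h h'
  exact congrArg₂ _ h h'

/-- The matrix elements `⟨m| Φ(X) |n⟩ = (1/2π) ∫_X e^{i(m-n)θ} dθ`, which determine the bounded
operator `Φ(X)`. -/
theorem phaseOp_matrix (X : Set PhaseSpace) (m n : ℕ) :
    ⟪(lp.single 2 m (1 : ℂ) : FockSpace), phaseOp X (lp.single 2 n (1 : ℂ) : FockSpace)⟫_ℂ =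
      1 / (2 * Real.pi) * ∫ θ in (Subtype.val '' X : Set ℝ),
        Complex.exp (Complex.I * ((m : ℂ) - n) * θ) := by
  have h : ∀ k : ℕ, phaseIsometry (lp.single 2 k (1 : ℂ) : FockSpace) =
      (memLp_phaseChar k).toLp (phaseChar k) := fun k => by
    rw [phaseIsometry, OrthogonalFamily.linearIsometry_apply_single]
    simp
  rw [inner_phaseOp, h, h, ← setIntegral_phaseMeasure X
    (fun θ : ℝ => Complex.exp (Complex.I * ((m : ℂ) - n) * θ))]
  refine integral_congr_ae (ae_restrict_of_ae ?_)
  filter_upwards [(memLp_phaseChar m).coeFn_toLp, (memLp_phaseChar n).coeFn_toLp] with θ h h'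
  rw [h, h', inner_phaseChar]

/-- The canonical phase observable
`Φ(X) = ∑_{m,n} (1/2π) ∫_X e^{i(m-n)θ} dθ |m⟩⟨n|` with outcome space `[0, 2π)`. -/
def phaseObservable : Observable PhaseSpace FockSpace where
  toFun := phaseOp
  isPositive' X _ := ContinuousLinearMap.isPositive_adjoint_comp_self _
  map_univ' := by
    refine ContinuousLinearMap.ext fun ψ => ext_inner_left ℂ fun φ => ?_
    rw [inner_phaseOp, Measure.restrict_univ, ← L2.inner_def, LinearIsometry.inner_map_map]
    rfl
  hasSum_iUnion' X hX hd φ ψ := by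
    simp only [inner_phaseOp]
    exact hasSum_integral_iUnion hX hd (L2.integrable_inner (𝕜 := ℂ) _ _).integrableOn

end QuantumObservables

end

open MeasureTheory Set
open scoped InnerProductSpace ENNReal

noncomputable section

namespace QuantumObservables

/-! ### Outcome distributions of observables, and the easy inclusion. -/

section General

variable {Ω Ω₁ Ω₂ : Type*} [MeasurableSpace Ω] [MeasurableSpace Ω₁] [MeasurableSpace Ω₂]
  {H : Type*} [NormedAddCommGroup H] [InnerProductSpace ℂ H]

/-! Points with `s + t ≤ 1` are reached by tossing a coin to decide which observable to measure,
assigning a fixed outcome to the other.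

For the converse, let `M` have margins `s N + (1 - s) p 1` and `t Φ + (1 - t) T₂`. Cut the circle
into `r` arcs and take, for each arc, a uniform superposition of the number states in the window `F
= [K, K + m)`, with its phase peaked at the centre of the arc. The second margin puts mass at least
`t (1 - r² / m)` on `ℕ ×` arc. Outside `F` only the noise of the first margin contributes, at most
`1 - s`, so the cells `{n} ×` arc with `n ∈ F` must carry the rest. Such a cell sees essentially
only the component along `|n⟩`, of weight `1 / m`: by positivity it is bounded by twice that
component's share plus `2 p {n}` (`distribution_singleton_prod_le`). The states `|n⟩` do not depend
on the arc and the arcs are disjoint, so summed over all arcs and all `n` these shares total at most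
`1`, hence only `1 / r` per arc on average. Thus `s + t - 1 ≤ 2 / r + 2 p [K, ∞) + r² / m`
(`add_sub_one_le_of_joint`), and the right side can be made arbitrarily small. -/

theorem Observable.inner_map_empty (M : Observable Ω H) (φ ψ : H) : ⟪φ, M ∅ ψ⟫_ℂ = 0 := by
  have h := M.hasSum_iUnion' (fun _ => ∅) (fun _ => MeasurableSet.empty)
    (fun _ _ _ => disjoint_bot_left) φ ψ
  -- Additivity over countably many empty sets makes a constant series summable, so the constant
  -- vanishes.
  exact (summable_const_iff _).1 h.summable

theorem Observable.map_empty (M : Observable Ω H) : M ∅ = 0 :=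
  ContinuousLinearMap.ext fun ψ => ext_inner_left ℂ fun φ => by simp [M.inner_map_empty]

theorem Observable.re_inner_nonneg (M : Observable Ω H) (ψ : H) {X : Set Ω}
    (hX : MeasurableSet X) : 0 ≤ (⟪ψ, M X ψ⟫_ℂ).re :=
  (M.isPositive' X hX).re_inner_nonneg_right ψ

/-- The outcome distribution of `M` in the (not necessarily normalized) vector state `ψ`. -/
def Observable.distribution (M : Observable Ω H) (ψ : H) : Measure Ω :=
  Measure.ofMeasurable (fun X _ => ENNReal.ofReal (⟪ψ, M X ψ⟫_ℂ).re)
    (by simp [M.inner_map_empty])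
    (fun X hX hd => by
      have h := Complex.hasSum_re (M.hasSum_iUnion' X hX hd ψ ψ)
      rw [← h.tsum_eq]
      exact ENNReal.ofReal_tsum_of_nonneg (fun i => M.re_inner_nonneg ψ (hX i)) h.summable)

theorem Observable.distribution_apply (M : Observable Ω H) (ψ : H) {X : Set Ω}
    (hX : MeasurableSet X) : M.distribution ψ X = ENNReal.ofReal (⟪ψ, M X ψ⟫_ℂ).re :=
  Measure.ofMeasurable_apply X hX

theorem Observable.distribution_real (M : Observable Ω H) (ψ : H) {X : Set Ω}
    (hX : MeasurableSet X) : (M.distribution ψ).real X = (⟪ψ, M X ψ⟫_ℂ).re := by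
  rw [measureReal_def, M.distribution_apply ψ hX, ENNReal.toReal_ofReal (M.re_inner_nonneg ψ hX)]

instance (M : Observable Ω H) (ψ : H) : IsFiniteMeasure (M.distribution ψ) :=
  ⟨by rw [M.distribution_apply ψ MeasurableSet.univ]; exact ENNReal.ofReal_lt_top⟩

theorem Observable.distribution_real_univ (M : Observable Ω H) (ψ : H) :
    (M.distribution ψ).real univ = ‖ψ‖ ^ 2 := by
  rw [M.distribution_real ψ MeasurableSet.univ, M.map_univ', one_apply_eq_self]
  exact inner_self_eq_norm_sq (𝕜 := ℂ) ψ

/-- Parallelogram law for the positive form of `M X`, with the nonnegative term at `φ - ψ` dropped.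
It removes cross terms at the price of a factor 2, which is harmless in the limit. -/
theorem Observable.distribution_real_add_le (M : Observable Ω H) (φ ψ : H) {X : Set Ω}
    (hX : MeasurableSet X) : (M.distribution (φ + ψ)).real X ≤
      2 * (M.distribution φ).real X + 2 * (M.distribution ψ).real X := by
  have h := M.re_inner_nonneg (φ - ψ) hX
  simp only [M.distribution_real _ hX]
  simp only [map_sub, map_add, inner_sub_left, inner_sub_right, inner_add_left, inner_add_right,
    Complex.add_re, Complex.sub_re] at h ⊢
  linarith

theorem Observable.distribution_real_smul (M : Observable Ω H) (c : ℂ) (ψ : H) {X : Set Ω}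
    (hX : MeasurableSet X) :
    (M.distribution (c • ψ)).real X = ‖c‖ ^ 2 * (M.distribution ψ).real X := by
  simp only [M.distribution_real _ hX]
  rw [map_smul, inner_smul_left, inner_smul_right, ← mul_assoc, mul_comm ((starRingEnd ℂ) c),
    Complex.mul_conj, Complex.re_ofReal_mul, Complex.normSq_eq_norm_sq]

theorem Observable.distribution_mix_real (t : ℝ) (ht : t ∈ Icc (0 : ℝ) 1) (M T : Observable Ω H)
    (ψ : H) {X : Set Ω} (hX : MeasurableSet X) :
    ((Observable.mix t ht M T).distribution ψ).real X =
      t * (M.distribution ψ).real X + (1 - t) * (T.distribution ψ).real X := by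
  simp only [Observable.distribution_real _ _ hX]
  simp only [Observable.mix, add_apply, smul_apply, inner_add_right, inner_smul_right,
    Complex.add_re, Complex.re_ofReal_mul]

/-- The image of an observable under a measurable map of outcome spaces. -/
def Observable.map (f : Ω₁ → Ω₂) (hf : Measurable f) (M : Observable Ω₁ H) : Observable Ω₂ H where
  toFun X := M (f ⁻¹' X)
  isPositive' X hX := M.isPositive' _ (hf hX)
  map_univ' := M.map_univ'
  hasSum_iUnion' X hX hd φ ψ := by
    rw [preimage_iUnion]
    exact M.hasSum_iUnion' _ (fun i => hf (hX i)) (fun i j hij => (hd hij).preimage f) φ ψ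

/-- The trivial observable given by a probability measure. -/
def Observable.ofMeasure (μ : Measure Ω) [IsProbabilityMeasure μ] : Observable Ω H where
  toFun X := ((μ.real X : ℝ) : ℂ) • (1 : H →L[ℂ] H)
  isPositive' X _ := ContinuousLinearMap.isPositive_one.smul_of_nonneg
    (by exact_mod_cast measureReal_nonneg)
  map_univ' := by simp
  hasSum_iUnion' X hX hd φ ψ := by
    simp only [smul_apply, inner_smul_right]
    refine HasSum.mul_right _ (Complex.hasSum_ofReal.2 ?_)
    have h : ∑' i, μ (X i) ≠ ⊤ := by
      rw [← measure_iUnion hd hX]; exact measure_ne_top μ _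
    have h2 := ENNReal.hasSum_toReal h
    rwa [← ENNReal.tsum_toReal_eq (fun i => measure_ne_top μ _), ← measure_iUnion hd hX] at h2

/-- The three-fold convex combination `s M₁ + t M₂ + (1 - s - t) M₃` of observables. -/
def Observable.mix₃ (s t : ℝ) (hs : 0 ≤ s) (ht : 0 ≤ t) (hst : s + t ≤ 1)
    (M₁ M₂ M₃ : Observable Ω H) : Observable Ω H where
  toFun X := (s : ℂ) • M₁ X + (t : ℂ) • M₂ X + ((1 - s - t : ℝ) : ℂ) • M₃ X
  isPositive' X hX :=
    (((M₁.isPositive' X hX).smul_of_nonneg (by exact_mod_cast hs)).add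
      ((M₂.isPositive' X hX).smul_of_nonneg (by exact_mod_cast ht))).add
      ((M₃.isPositive' X hX).smul_of_nonneg (by exact_mod_cast (by linarith : 0 ≤ 1 - s - t)))
  map_univ' := by
    rw [M₁.map_univ', M₂.map_univ', M₃.map_univ', ← add_smul, ← add_smul]
    simp
  hasSum_iUnion' X hX hd φ ψ := by
    have h := (((M₁.hasSum_iUnion' X hX hd φ ψ).mul_left (s : ℂ)).add
      ((M₂.hasSum_iUnion' X hX hd φ ψ).mul_left (t : ℂ))).add
      ((M₃.hasSum_iUnion' X hX hd φ ψ).mul_left ((1 - s - t : ℝ) : ℂ))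
    simpa only [add_apply, smul_apply, inner_add_right, inner_smul_right] using h

/-- If `λ + μ ≤ 1` then measuring `M₁` with probability `λ`, `M₂` with probability `μ` and
nothing otherwise, with fixed default outcomes, realizes a joint measurement of noisy versions. -/
theorem mem_jointMeasurabilityRegion_of_add_le_one [Nonempty Ω₁] [Nonempty Ω₂]
    (M₁ : Observable Ω₁ H) (M₂ : Observable Ω₂ H) {s t : ℝ}
    (hs : s ∈ Icc (0 : ℝ) 1) (ht : t ∈ Icc (0 : ℝ) 1) (hst : s + t ≤ 1) :
    (s, t) ∈ jointMeasurabilityRegion M₁ M₂ := by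
  obtain ⟨x⟩ := ‹Nonempty Ω₁›
  obtain ⟨y⟩ := ‹Nonempty Ω₂›
  refine ⟨hs, ht, .ofMeasure (Measure.dirac x), .ofMeasure (Measure.dirac y),
    ⟨_, inferInstance, fun _ _ => rfl⟩, ⟨_, inferInstance, fun _ _ => rfl⟩,
    .mix₃ s t hs.1 ht.1 hst (M₁.map (·, y) (by fun_prop)) (M₂.map (x, ·) (by fun_prop))
      (.ofMeasure (Measure.dirac (x, y))), fun X hX => ?_, fun Y hY => ?_⟩
  · have h₁ : (fun a => (a, y)) ⁻¹' (X ×ˢ (univ : Set Ω₂)) = X := by ext; simp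
    have h₂ : (fun b : Ω₂ => (x, b)) ⁻¹' (X ×ˢ univ) = {_b : Ω₂ | x ∈ X} := by ext; simp
    simp only [Observable.mix₃, Observable.map, Observable.ofMeasure, Observable.mix, h₁, h₂]
    rw [measureReal_def, measureReal_def, Measure.dirac_apply' _ (hX.prod .univ),
      Measure.dirac_apply' _ hX]
    -- In the first margin the `M₂` branch always reports `x`. If `x ∈ X` it contributes `t` times
    -- the identity, and `t + (1 - s - t) = 1 - s` is the weight of the noise; otherwise it
    -- contributes `M₂ ∅ = 0`.
    by_cases h : x ∈ X
    · simp only [h, ofPred_true, M₂.map_univ', mem_prod, mem_univ, and_true, indicator_of_mem,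
        Pi.one_apply, ENNReal.toReal_one, Complex.ofReal_one, one_smul]
      push_cast
      module
    · have := M₂.map_empty
      simp [h, this]
  · have h₁ : (fun a : Ω₁ => (a, y)) ⁻¹' (univ ×ˢ Y) = {_a : Ω₁ | y ∈ Y} := by ext; simp
    have h₂ : (fun b : Ω₂ => (x, b)) ⁻¹' ((univ : Set Ω₁) ×ˢ Y) = Y := by ext; simp
    simp only [Observable.mix₃, Observable.map, Observable.ofMeasure, Observable.mix, h₁, h₂]
    rw [measureReal_def, measureReal_def, Measure.dirac_apply' _ (MeasurableSet.univ.prod hY),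
      Measure.dirac_apply' _ hY]
    by_cases h : y ∈ Y
    · simp only [h, ofPred_true, M₁.map_univ', mem_prod, mem_univ, true_and, indicator_of_mem,
        Pi.one_apply, ENNReal.toReal_one, Complex.ofReal_one, one_smul]
      push_cast
      module
    · have := M₁.map_empty
      simp [h, this]

end General

theorem distribution_numberObservable_eq_zero {ψ : FockSpace} {Y : Set ℕ}
    (h : ∀ n ∈ Y, ψ n = 0) : (numberObservable.distribution ψ).real Y = 0 := by
  have h0 : numberOp Y ψ = 0 := by
    ext n
    by_cases hn : n ∈ Y <;> simp [numberOp_apply, hn, h]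
  rw [Observable.distribution_real _ _ MeasurableSet.of_discrete]
  change (⟪ψ, numberOp Y ψ⟫_ℂ).re = 0
  simp [h0]

/-- The noise depends on the state only through its norm, so moving the window `[K, K + m)` far out
makes its mass there small, uniformly over the test states. -/
theorem Observable.IsTrivial.exists_distribution_real {Ω H : Type*} [MeasurableSpace Ω]
    [NormedAddCommGroup H] [InnerProductSpace ℂ H] {T : Observable Ω H} (hT : T.IsTrivial) :
    ∃ μ : Measure Ω, IsProbabilityMeasure μ ∧ ∀ (ψ : H) (X : Set Ω), MeasurableSet X →
      (T.distribution ψ).real X = μ.real X * ‖ψ‖ ^ 2 := by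
  obtain ⟨μ, hμ, h⟩ := hT
  refine ⟨μ, hμ, fun ψ X hX => ?_⟩
  have h2 : (⟪ψ, ψ⟫_ℂ).re = ‖ψ‖ ^ 2 := inner_self_eq_norm_sq (𝕜 := ℂ) ψ
  rw [T.distribution_real ψ hX, h X hX, smul_apply, one_apply_eq_self,
    inner_smul_right, Complex.re_ofReal_mul, h2]

/-! ### Test states with concentrated phase. -/

/-- The superposition of the number states `|n⟩`, `K ≤ n < K + m`, with equal weights, whose phase
is concentrated around `t`. -/
def phaseState (K m : ℕ) (t : ℝ) : FockSpace :=
  ∑ n ∈ Finset.Ico K (K + m),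
    ((√m)⁻¹ * Complex.exp (n * t * Complex.I) : ℂ) • lp.single 2 n (1 : ℂ)

theorem phaseState_apply (K m : ℕ) (t : ℝ) (n : ℕ) : phaseState K m t n =
    if n ∈ Finset.Ico K (K + m) then ((√m)⁻¹ * Complex.exp (n * t * Complex.I) : ℂ) else 0 := by
  rw [phaseState, lp.coeFn_sum, Finset.sum_apply]
  simp only [lp.coeFn_smul, Pi.smul_apply, lp.single_apply, Pi.single_apply, smul_eq_mul,
    mul_ite, mul_one, mul_zero, Finset.sum_ite_eq]

theorem norm_phaseState_apply_sq {K m : ℕ} (t : ℝ) {n : ℕ} (hn : n ∈ Finset.Ico K (K + m)) :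
    ‖phaseState K m t n‖ ^ 2 = (m : ℝ)⁻¹ := by
  have h : (n : ℂ) * t * Complex.I = ((n * t : ℝ) : ℂ) * Complex.I := by push_cast; ring
  rw [phaseState_apply, if_pos hn, h, norm_mul, Complex.norm_exp_ofReal_mul_I, mul_one,
    Complex.norm_real, norm_inv, Real.norm_eq_abs, inv_pow, sq_abs, Real.sq_sqrt (by positivity)]

theorem norm_phaseState_sq (K : ℕ) {m : ℕ} (hm : 0 < m) (t : ℝ) : ‖phaseState K m t‖ ^ 2 = 1 := by
  have h1 : (⟪phaseState K m t, phaseState K m t⟫_ℂ).re = ‖phaseState K m t‖ ^ 2 :=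
    inner_self_eq_norm_sq (𝕜 := ℂ) _
  have h2 : ∀ n, ⟪phaseState K m t n, phaseState K m t n⟫_ℂ = ((‖phaseState K m t n‖ ^ 2 : ℝ) : ℂ) :=
    fun n => by rw [inner_self_eq_norm_sq_to_K]; norm_cast
  rw [← h1, lp.inner_eq_tsum, tsum_eq_sum (s := Finset.Ico K (K + m))]
  · rw [Finset.sum_congr rfl fun n hn => by rw [h2, norm_phaseState_apply_sq t hn]]
    have : (m : ℝ) ≠ 0 := by positivity
    simp [this]
  · intro n hn
    rw [phaseState_apply, if_neg hn, inner_zero_left]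

theorem phaseIsometry_sum_single (s : Finset ℕ) (c : ℕ → ℂ) :
    phaseIsometry (∑ n ∈ s, c n • lp.single 2 n (1 : ℂ)) =ᵐ[phaseMeasure]
      fun θ => ∑ n ∈ s, c n * phaseChar n θ := by
  induction s using Finset.induction_on with
  | empty =>
    simp only [Finset.sum_empty, map_zero]
    exact Lp.coeFn_zero _ _ _
  | insert a s ha ih =>
    have h : phaseIsometry (lp.single 2 a (1 : ℂ) : FockSpace) =
        (memLp_phaseChar a).toLp (phaseChar a) := by
      rw [phaseIsometry, OrthogonalFamily.linearIsometry_apply_single]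
      simp
    rw [Finset.sum_insert ha, map_add, map_smul, h]
    filter_upwards [ih, Lp.coeFn_add (c a • (memLp_phaseChar a).toLp (phaseChar a))
      (phaseIsometry (∑ n ∈ s, c n • lp.single 2 n (1 : ℂ))),
      Lp.coeFn_smul (c a) ((memLp_phaseChar a).toLp (phaseChar a)),
      (memLp_phaseChar a).coeFn_toLp] with θ h₁ h₂ h₃ h₄
    rw [h₂, Pi.add_apply, h₁, h₃, Pi.smul_apply, h₄, Finset.sum_insert ha, smul_eq_mul]

/-- Away from `t` the phase amplitude of `phaseState K m t` is of order `1 / √m`. -/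
theorem norm_phaseState_amplitude_sq_le (K : ℕ) {m : ℕ} (t : ℝ) {r : ℝ} (hr : 0 < r)
    (θ : PhaseSpace) (h : 2 / r ≤ ‖Complex.exp (Complex.I * ((t - θ : ℝ) : ℂ)) - 1‖) :
    ‖∑ n ∈ Finset.Ico K (K + m), ((√m)⁻¹ * Complex.exp (n * t * Complex.I) : ℂ) * phaseChar n θ‖ ^ 2
      ≤ r ^ 2 / m := by
  set z := Complex.exp (Complex.I * ((t - θ : ℝ) : ℂ)) with hz
  have hz1 : ‖z‖ = 1 := by rw [hz, mul_comm, Complex.norm_exp_ofReal_mul_I]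
  have hsum : ∑ n ∈ Finset.Ico K (K + m),
      ((√m)⁻¹ * Complex.exp (n * t * Complex.I) : ℂ) * phaseChar n θ =
      (((√m)⁻¹ : ℝ) : ℂ) * ∑ n ∈ Finset.Ico K (K + m), z ^ n := by
    rw [Finset.mul_sum]
    refine Finset.sum_congr rfl fun n _ => ?_
    rw [mul_assoc, phaseChar, hz, ← Complex.exp_add, ← Complex.exp_nat_mul]
    congr 2
    push_cast
    ring
  have hpos : 0 < ‖z - 1‖ := lt_of_lt_of_le (by positivity) h
  -- The amplitude is a geometric sum: multiplied by `z - 1` it telescopes to a difference of two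
  -- unimodular numbers.
  have hgeom : ‖∑ n ∈ Finset.Ico K (K + m), z ^ n‖ ≤ r := by
    have h1 := geom_sum_Ico_mul z (Nat.le_add_right K m)
    have h2 : ‖∑ n ∈ Finset.Ico K (K + m), z ^ n‖ * ‖z - 1‖ ≤ 2 := by
      rw [← norm_mul, h1]
      refine (norm_sub_le _ _).trans ?_
      rw [norm_pow, norm_pow, hz1]
      norm_num
    have h3 := mul_le_mul_of_nonneg_left h (norm_nonneg (∑ n ∈ Finset.Ico K (K + m), z ^ n))
    have h4 : ‖∑ n ∈ Finset.Ico K (K + m), z ^ n‖ * (2 / r) ≤ 2 := h3.trans h2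
    rw [mul_div_assoc', div_le_iff₀ hr] at h4
    linarith
  rw [hsum, norm_mul, mul_pow, Complex.norm_real, norm_inv, Real.norm_eq_abs, inv_pow, sq_abs,
    Real.sq_sqrt (by positivity), div_eq_inv_mul]
  gcongr

/-- The arc `[2πj/r, 2π(j+1)/r)`. -/
def phaseArc (r j : ℕ) : Set PhaseSpace :=
  Subtype.val ⁻¹' Ico (2 * Real.pi / r * j) (2 * Real.pi / r * (j + 1 : ℕ))

theorem measurableSet_phaseArc (r j : ℕ) : MeasurableSet (phaseArc r j) :=
  measurable_subtype_coe measurableSet_Ico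

theorem pairwise_disjoint_phaseArc (r : ℕ) : Pairwise (Function.onFun Disjoint (phaseArc r)) := by
  have hmono : Monotone fun j : ℕ => 2 * Real.pi / r * j := fun i j hij => by
    have : (i : ℝ) ≤ j := by exact_mod_cast hij
    exact mul_le_mul_of_nonneg_left this (by positivity)
  exact fun i j hij => (hmono.pairwise_disjoint_on_Ico_succ hij).preimage Subtype.val

/-- A point off the arc has circular distance at least `π / r` from its centre. The chord is `2
|sin|` of half the angle, and Jordan's inequality `sin y ≥ 2 y / π` at `y = π / (2 r)` gives exactly
`1 / r`. -/
theorem two_div_le_norm_of_notMem_phaseArc {r j : ℕ} (hj : j < r) {θ : PhaseSpace}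
    (hθ : θ ∉ phaseArc r j) : 2 / (r : ℝ) ≤
      ‖Complex.exp (Complex.I * (((2 * j + 1) * (Real.pi / r) - θ : ℝ) : ℂ)) - 1‖ := by
  have hr : (0 : ℝ) < r := by exact_mod_cast Nat.zero_lt_of_lt hj
  have hjr : (j : ℝ) + 1 ≤ r := by exact_mod_cast hj
  have hpi := Real.pi_pos
  set q := Real.pi / r with hq
  have hq0 : 0 < q := by positivity
  have hrq : r * q = Real.pi := by rw [hq]; field_simp
  -- The upper limit `π - q / 2` accounts for the wrap-around of the circle; reflection `y ↦ π - y`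
  -- reduces to the first quadrant.
  have key : ∀ y : ℝ, q / 2 ≤ y → y ≤ Real.pi - q / 2 → 1 / (r : ℝ) ≤ Real.sin y := by
    have half : ∀ y : ℝ, q / 2 ≤ y → y ≤ Real.pi / 2 → 1 / (r : ℝ) ≤ Real.sin y := by
      intro y h1 h2
      refine le_trans ?_ (Real.mul_le_sin (by linarith) h2)
      calc 1 / (r : ℝ) = 2 / Real.pi * (q / 2) := by rw [hq]; field_simp
        _ ≤ _ := by gcongr
    intro y h1 h2
    rcases le_total y (Real.pi / 2) with h | h
    · exact half y h1 h
    · rw [← Real.sin_pi_sub]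
      exact half _ (by linarith) (by linarith)
  obtain ⟨h0, h2pi⟩ := θ.2
  have hmem : (θ : ℝ) < 2 * q * j ∨ 2 * q * (j + 1) ≤ (θ : ℝ) := by
    have h2q : 2 * Real.pi / r = 2 * q := by rw [hq]; ring
    rw [phaseArc, mem_preimage, mem_Ico, not_and_or, not_le, not_lt, h2q] at hθ
    exact_mod_cast hθ
  have hjq : ((j : ℝ) + 1) * q ≤ Real.pi := by rw [← hrq]; gcongr
  have hjq0 : 0 ≤ (j : ℝ) * q := by positivity
  rw [Complex.norm_exp_I_mul_ofReal_sub_one, norm_mul, Real.norm_eq_abs, Real.norm_eq_abs, abs_two]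
  have : 1 / (r : ℝ) ≤ |Real.sin (((2 * j + 1) * q - θ) / 2)| := by
    rcases hmem with h | h
    · exact (key _ (by linarith) (by linarith)).trans (le_abs_self _)
    · rw [← abs_neg, ← Real.sin_neg]
      exact (key _ (by linarith) (by linarith)).trans (le_abs_self _)
  calc 2 / (r : ℝ) = 2 * (1 / r) := by ring
    _ ≤ _ := by gcongr

/-- The total mass is 1, and off the arc the density is at most `r² / m` with respect to a
probability measure. -/
theorem le_distribution_phaseObservable_phaseArc (K : ℕ) {m : ℕ} (hm : 0 < m) {r j : ℕ}
    (hj : j < r) : 1 - (r : ℝ) ^ 2 / m ≤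
      (phaseObservable.distribution (phaseState K m ((2 * j + 1) * (Real.pi / r)))).real
        (phaseArc r j) := by
  set t : ℝ := (2 * j + 1) * (Real.pi / r)
  set ψ := phaseState K m t with hψ
  have hr : (0 : ℝ) < r := by exact_mod_cast Nat.zero_lt_of_lt hj
  have hA := measurableSet_phaseArc r j
  have huniv := phaseObservable.distribution_real_univ ψ
  rw [norm_phaseState_sq K hm, ← measureReal_add_measureReal_compl hA] at huniv
  suffices h : (phaseObservable.distribution ψ).real (phaseArc r j)ᶜ ≤ (r : ℝ) ^ 2 / m by linarith
  rw [Observable.distribution_real _ _ hA.compl]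
  change (⟪ψ, phaseOp _ ψ⟫_ℂ).re ≤ _
  rw [inner_phaseOp]
  refine (Complex.re_le_norm _).trans ?_
  have hbound : ∀ᵐ θ ∂phaseMeasure, θ ∈ (phaseArc r j)ᶜ →
      ‖⟪phaseIsometry ψ θ, phaseIsometry ψ θ⟫_ℂ‖ ≤ (r : ℝ) ^ 2 / m := by
    filter_upwards [phaseIsometry_sum_single (Finset.Ico K (K + m))
      fun n => ((√m)⁻¹ * Complex.exp (n * t * Complex.I) : ℂ)] with θ h hθ
    rw [inner_self_eq_norm_sq_to_K, norm_pow, RCLike.norm_ofReal, abs_norm, hψ, phaseState, h]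
    exact norm_phaseState_amplitude_sq_le K t hr θ (two_div_le_norm_of_notMem_phaseArc hj hθ)
  refine (norm_setIntegral_le_of_norm_le_const_ae' (measure_lt_top _ _) hbound).trans ?_
  exact mul_le_of_le_one_right (by positivity) measureReal_le_one

/-! ### Bounds on a joint observable. -/

open Filter Topology in
theorem tendsto_measureReal_Ici_atTop (p : Measure ℕ) [IsFiniteMeasure p] :
    Tendsto (fun K => p.real (Ici K)) atTop (𝓝 0) := by
  have hanti : Antitone fun K : ℕ => (Ici K : Set ℕ) := fun a b h => Ici_subset_Ici.2 h
  have h := tendsto_measure_iInter_atTop (μ := p)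
    (fun K : ℕ => (measurableSet_Ici (a := K)).nullMeasurableSet) hanti ⟨0, measure_ne_top _ _⟩
  have h0 : ⋂ K : ℕ, (Ici K : Set ℕ) = ∅ :=
    eq_empty_of_forall_notMem fun n hn => by simpa using mem_iInter.1 hn (n + 1)
  rw [h0, measure_empty] at h
  exact (ENNReal.tendsto_toReal ENNReal.zero_ne_top).comp h

/-- The outcome statistics of a joint observable with first margin `s N + (1 - s) p` on the
cell `{n} × Y` is controlled by that of the number state `|n⟩`. -/
theorem distribution_singleton_prod_le {s : ℝ} (hs : s ∈ Icc (0 : ℝ) 1)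
    {T : Observable ℕ FockSpace} {p : Measure ℕ}
    (hp : ∀ (ψ : FockSpace) (X : Set ℕ), MeasurableSet X →
      (T.distribution ψ).real X = p.real X * ‖ψ‖ ^ 2)
    {M : Observable (ℕ × PhaseSpace) FockSpace}
    (hM : ∀ X, MeasurableSet X → M (X ×ˢ univ) = Observable.mix s hs numberObservable T X)
    {ψ : FockSpace} (hψ : ‖ψ‖ ≤ 1) (n : ℕ) {Y : Set PhaseSpace} (hY : MeasurableSet Y) :
    (M.distribution ψ).real ({n} ×ˢ Y) ≤
      2 * (‖ψ n‖ ^ 2 * (M.distribution (lp.single 2 n (1 : ℂ))).real ({n} ×ˢ Y)) +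
        2 * p.real {n} := by
  have hZ : MeasurableSet (({n} : Set ℕ) ×ˢ Y) := (MeasurableSet.singleton n).prod hY
  set φ := numberOp {n}ᶜ ψ with hφ
  have hdec : ψ = ψ n • lp.single 2 n (1 : ℂ) + φ := by
    ext k
    rw [lp.coeFn_add, lp.coeFn_smul, Pi.add_apply, Pi.smul_apply, hφ, numberOp_apply,
      lp.single_apply]
    by_cases h : k = n
    · subst h; simp
    · simp [h]
  have hφ1 : ‖φ‖ ≤ 1 :=
    (lp.norm_mono (by norm_num) fun k => norm_indicator_le_norm_self ψ k).trans hψ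
  have h1 := M.distribution_real_add_le (ψ n • lp.single 2 n (1 : ℂ)) φ hZ
  rw [← hdec, M.distribution_real_smul _ _ hZ] at h1
  -- Enlarging `Y` to the whole circle brings in the first margin. Since `φ` has no component along
  -- `|n⟩`, its number part vanishes on `{n}` and only noise remains.
  have h2 : (M.distribution φ).real ({n} ×ˢ Y) ≤ p.real {n} := by
    calc (M.distribution φ).real ({n} ×ˢ Y) ≤ (M.distribution φ).real ({n} ×ˢ univ) :=
          measureReal_mono (prod_mono_right (subset_univ Y))
      _ = ((Observable.mix s hs numberObservable T).distribution φ).real {n} := by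
          rw [Observable.distribution_real _ _ ((MeasurableSet.singleton n).prod .univ),
            Observable.distribution_real _ _ (.singleton n), hM _ (.singleton n)]
      _ = (1 - s) * (p.real {n} * ‖φ‖ ^ 2) := by
          rw [Observable.distribution_mix_real _ _ _ _ _ (.singleton n),
            distribution_numberObservable_eq_zero, hp _ _ (.singleton n)]
          · ring
          · rintro k rfl
            simp [hφ, numberOp_apply]
      _ ≤ 1 * (p.real {n} * 1) := by
          have := hs.1
          gcongr
          · linarith
          · exact pow_le_one₀ (norm_nonneg _) hφ1
      _ = p.real {n} := by ring
  linarith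

/-- Summing the statistics of a joint observable over the states `phaseState K m t`, where `t` runs
through the centres of the `r` arcs of length `2π/r`, each evaluated on its own arc. -/
theorem add_sub_one_le_of_joint {s t : ℝ} (hs : s ∈ Icc (0 : ℝ) 1) (ht : t ∈ Icc (0 : ℝ) 1)
    {T₁ : Observable ℕ FockSpace} {T₂ : Observable PhaseSpace FockSpace}
    {p : Measure ℕ} [IsProbabilityMeasure p]
    (hp : ∀ (ψ : FockSpace) (X : Set ℕ), MeasurableSet X →
      (T₁.distribution ψ).real X = p.real X * ‖ψ‖ ^ 2)
    {M : Observable (ℕ × PhaseSpace) FockSpace}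
    (hM₁ : ∀ X, MeasurableSet X → M (X ×ˢ univ) = Observable.mix s hs numberObservable T₁ X)
    (hM₂ : ∀ Y, MeasurableSet Y → M (univ ×ˢ Y) = Observable.mix t ht phaseObservable T₂ Y)
    (K : ℕ) {m r : ℕ} (hm : 0 < m) (hr : 0 < r) :
    s + t - 1 ≤ 2 / r + 2 * p.real (Ici K) + r ^ 2 / m := by
  set F := Finset.Ico K (K + m) with hF
  set c : ℕ → ℝ := fun j => (2 * j + 1) * (Real.pi / r) with hc
  have hY := measurableSet_phaseArc r
  have hnorm : ∀ j, ‖phaseState K m (c j)‖ ≤ 1 := fun j =>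
    (sq_le_one_iff₀ (norm_nonneg _)).1 (norm_phaseState_sq K hm (c j)).le
  have hmain : ∀ j < r, t * (1 - (r : ℝ) ^ 2 / m) ≤ (1 - s) + ∑ n ∈ F,
      (2 * ((m : ℝ)⁻¹ * (M.distribution (lp.single 2 n (1 : ℂ))).real ({n} ×ˢ phaseArc r j)) +
        2 * p.real {n}) := by
    intro j hj
    set ψ := phaseState K m (c j) with hψ
    have h1 : t * (1 - (r : ℝ) ^ 2 / m) ≤ (M.distribution ψ).real (univ ×ˢ phaseArc r j) := by
      rw [Observable.distribution_real _ _ (MeasurableSet.univ.prod (hY j)), hM₂ _ (hY j),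
        ← Observable.distribution_real _ _ (hY j), Observable.distribution_mix_real _ _ _ _ _ (hY j)]
      have h2 := mul_le_mul_of_nonneg_left
        (le_distribution_phaseObservable_phaseArc K hm hj) ht.1
      have h3 : 0 ≤ (1 - t) * (T₂.distribution ψ).real (phaseArc r j) :=
        mul_nonneg (sub_nonneg.2 ht.2) measureReal_nonneg
      linarith
    have hcover : (univ : Set ℕ) ×ˢ phaseArc r j ⊆
        ((F : Set ℕ)ᶜ ×ˢ univ) ∪ ⋃ n ∈ F, {n} ×ˢ phaseArc r j := by
      rintro ⟨n, θ⟩ ⟨-, hθ⟩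
      by_cases hn : n ∈ F
      · exact Or.inr (mem_iUnion₂.2 ⟨n, hn, rfl, hθ⟩)
      · exact Or.inl ⟨hn, mem_univ _⟩
    have h4 : (M.distribution ψ).real ((F : Set ℕ)ᶜ ×ˢ univ) ≤ 1 - s := by
      have hFm : MeasurableSet ((F : Set ℕ)ᶜ) := .of_discrete
      rw [Observable.distribution_real _ _ (hFm.prod .univ), hM₁ _ hFm,
        ← Observable.distribution_real _ _ hFm, Observable.distribution_mix_real _ _ _ _ _ hFm,
        distribution_numberObservable_eq_zero, hp _ _ hFm, norm_phaseState_sq K hm, mul_zero,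
        zero_add, mul_one]
      · exact mul_le_of_le_one_right (sub_nonneg.2 hs.2) measureReal_le_one
      · intro n hn
        rw [hψ, phaseState_apply]
        exact if_neg hn
    calc t * (1 - (r : ℝ) ^ 2 / m) ≤ (M.distribution ψ).real (univ ×ˢ phaseArc r j) := h1
      _ ≤ (M.distribution ψ).real (((F : Set ℕ)ᶜ ×ˢ univ) ∪ ⋃ n ∈ F, {n} ×ˢ phaseArc r j) :=
          measureReal_mono hcover
      _ ≤ (1 - s) + ∑ n ∈ F, (M.distribution ψ).real ({n} ×ˢ phaseArc r j) :=
          (measureReal_union_le _ _).trans (add_le_add h4 (measureReal_biUnion_finset_le _ _))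
      _ ≤ _ := by
          gcongr with n hn
          rw [← norm_phaseState_apply_sq (c j) hn]
          exact distribution_singleton_prod_le hs hp hM₁ (hnorm j) n (hY j)
  -- For fixed `n` the cells are disjoint events in the single state `|n⟩`. This is where
  -- incompatibility enters: a number state cannot favour every arc at once.
  have hcell : ∀ n, ∑ j ∈ Finset.range r,
      (M.distribution (lp.single 2 n (1 : ℂ))).real ({n} ×ˢ phaseArc r j) ≤ 1 := by
    intro n
    have hd : ((Finset.range r : Finset ℕ) : Set ℕ).PairwiseDisjoint
        fun j => ({n} : Set ℕ) ×ˢ phaseArc r j :=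
      fun i _ j _ hij => Disjoint.set_prod_right (pairwise_disjoint_phaseArc r hij) _ _
    refine (sum_measureReal_le_measureReal_univ
      (fun j _ => (MeasurableSet.singleton n).prod (hY j)) hd).trans ?_
    · rw [Observable.distribution_real_univ, lp.norm_single (by norm_num)]
      simp
  have htail : ∑ n ∈ F, p.real {n} ≤ p.real (Ici K) := by
    rw [← measureReal_biUnion_finset (fun i _ j _ hij => disjoint_singleton.2 hij)
      (fun n _ => .singleton n)]
    refine measureReal_mono (iUnion₂_subset fun n hn => ?_)
    simpa using (Finset.mem_Ico.1 hn).1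
  have hsum := Finset.sum_le_sum fun j hj => hmain j (Finset.mem_range.1 hj)
  have hm' : (0 : ℝ) < m := by exact_mod_cast hm
  have hr' : (0 : ℝ) < r := by exact_mod_cast hr
  have hdouble : ∑ n ∈ F, (m : ℝ)⁻¹ * ∑ j ∈ Finset.range r,
      (M.distribution (lp.single 2 n (1 : ℂ))).real ({n} ×ˢ phaseArc r j) ≤ 1 := by
    calc _ ≤ ∑ n ∈ F, (m : ℝ)⁻¹ * 1 := by gcongr with n; exact hcell n
      _ = 1 := by simp [hF, hm'.ne']
  simp only [Finset.sum_add_distrib, ← Finset.mul_sum, Finset.sum_const, Finset.card_range,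
    nsmul_eq_mul] at hsum
  rw [Finset.sum_comm] at hsum
  simp only [← Finset.mul_sum] at hsum hdouble
  have hq : t * ((r : ℝ) ^ 2 / m) ≤ (r : ℝ) ^ 2 / m :=
    mul_le_of_le_one_left (by positivity) ht.2
  -- Summed over `j`, every term scales with `r` except the double sum, which contributes only `2`;
  -- dividing by `r` turns it into `2 / r`.
  have h5 : r * (s + t - 1) ≤ r * (2 / r + 2 * p.real (Ici K) + (r : ℝ) ^ 2 / m) := by
    have h6 := mul_le_mul_of_nonneg_left hq hr'.le
    have h7 := mul_le_mul_of_nonneg_left htail hr'.le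
    have h8 : (r : ℝ) * (2 / r) = 2 := by field_simp
    rw [mul_add, mul_add, h8]
    linarith
  exact le_of_mul_le_mul_left h5 hr'

open Filter Topology in
-- The limits are taken in the order `K`, `m`, `r`: the noise tail vanishes for fixed `m` and `r`,
-- and `r² / m` must vanish before `r` grows.
theorem add_le_one_of_mem_jointMeasurabilityRegion {s t : ℝ}
    (h : (s, t) ∈ jointMeasurabilityRegion numberObservable phaseObservable) : s + t ≤ 1 := by
  obtain ⟨hs, ht, T₁, T₂, hT₁, -, M, hM₁, hM₂⟩ := h
  obtain ⟨p, hp₁, hp⟩ := hT₁.exists_distribution_real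
  have hK : ∀ m r : ℕ, 0 < m → 0 < r → s + t - 1 ≤ 2 / r + 2 * 0 + (r : ℝ) ^ 2 / m :=
    fun m r hm hr => ge_of_tendsto' (((tendsto_measureReal_Ici_atTop p).const_mul 2).const_add
      (2 / (r : ℝ)) |>.add_const _) fun K => add_sub_one_le_of_joint hs ht hp hM₁ hM₂ K hm hr
  have hm : ∀ r : ℕ, 0 < r → s + t - 1 ≤ 2 / (r : ℝ) + 2 * 0 + 0 := fun r hr =>
    ge_of_tendsto ((tendsto_const_div_atTop_nhds_zero_nat ((r : ℝ) ^ 2)).const_add _)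
      ((eventually_gt_atTop 0).mono fun m hm => hK m r hm hr)
  have hr : s + t - 1 ≤ 0 + 2 * 0 + 0 :=
    ge_of_tendsto (((tendsto_const_div_atTop_nhds_zero_nat (2 : ℝ)).add_const _).add_const _)
      ((eventually_gt_atTop 0).mono fun r hr => hm r hr)
  linarith

instance : Nonempty PhaseSpace := ⟨⟨0, le_rfl, by positivity⟩⟩

theorem mem_jointMeasurabilityRegion_number_phase_iff {s t : ℝ} :
    (s, t) ∈ jointMeasurabilityRegion numberObservable phaseObservable ↔
      s ∈ Icc (0 : ℝ) 1 ∧ t ∈ Icc (0 : ℝ) 1 ∧ s + t ≤ 1 :=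
  ⟨fun h => ⟨h.1, h.2.1, add_le_one_of_mem_jointMeasurabilityRegion h⟩,
    fun h => mem_jointMeasurabilityRegion_of_add_le_one _ _ h.1 h.2.1 h.2.2⟩

end QuantumObservables

end

theorem theorem3 :
    QuantumObservables.MaximallyIncompatible
        QuantumObservables.numberObservable QuantumObservables.phaseObservable ∧
      QuantumObservables.IsJointMeasurabilityDegree
        QuantumObservables.numberObservable QuantumObservables.phaseObservable (1 / 2) := by
  refine ⟨Set.ext fun ⟨s, t⟩ =>
    QuantumObservables.mem_jointMeasurabilityRegion_number_phase_iff, ?_, fun t ht => ?_⟩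
  · exact QuantumObservables.mem_jointMeasurabilityRegion_number_phase_iff.2 (by norm_num)
  · have := (QuantumObservables.mem_jointMeasurabilityRegion_number_phase_iff.1 ht).2.2
    linarith
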